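/- For $\tau$ in the upper half-plane put $q=e^{2\pi i\tau}$, $\sigma_k(n)=\sum_{d\mid n}d^k$, and let $E_2=1-24\sum_{n\ge1}\sigma_1(n)q^n$, $E_4=1+240\sum_{n\ge1}\sigma_3(n)q^n$, $E_6=1-504\sum_{n\ge1}\sigma_5(n)q^n$ be the normalized Eisenstein series. Put $E_2^*(\tau)=E_2(\tau)-\frac{3}{\pi\,\Im\tau}$, $\Delta(\tau)=q\prod_{n\ge1}(1-q^n)^{24}$, $j=E_4^3/\Delta$ and $J_1=j/1728$. Let $(x)_n=x(x+1)\cdots(x+n-1)$ and, for integers $d\ge2$ and $n\ge0$, $$R_n(d)=\prod_{\substack{1\le i\le d\\ \gcd(i,d)=1}}\frac{(i/d)_n}{n!}.$$ Then there is a constant $C>0$ such that for every $\tau$ with $\Im\tau>C$ the number $E_4(\tau)$ does not lie in $(-\infty,0]$, $E_6(\tau)\neq0$, $|J_1(\tau)|>1$, and, with principal branches of the powers of $E_4(\tau)$ and with both series absolutely convergent, $$E_4(\tau)^{1/2}={}_3F_2\left(\tfrac12,\tfrac16,\tfrac56;1,1;\tfrac1{J_1(\tau)}\right)=\sum_{n\ge0}\frac{(1/2)_n(1/6)_n(5/6)_n}{n!^3}\,\frac1{J_1(\tau)^n}$$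 and $$\sum_{n\ge0}\left(6n+1-\frac{E_2^*E_4}{E_6}(\tau)\right)\frac{R_n(2)R_n(6)}{J_1(\tau)^n}=\frac{3}{\pi\,\Im\tau}\,\frac{E_4^{3/2}}{E_6}(\tau).$$ -/

import Mathlib

open UpperHalfPlane ModularForm

noncomputable section

namespace Chudnovsky

/-- The Pochhammer symbol `(x)_n = x (x + 1) ⋯ (x + n - 1)`. -/
def poch (x : ℂ) (n : ℕ) : ℂ := (ascPochhammer ℂ n).eval x

/-- `R_n(d)`: the product over `1 ≤ i ≤ d` with `gcd (i, d) = 1` of `(i/d)_n / n!`. -/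
def R (n d : ℕ) : ℂ :=
  ∏ i ∈ (Finset.Icc 1 d).filter (fun i => Nat.gcd i d = 1),
    poch ((i : ℂ) / (d : ℂ)) n / (n.factorial : ℂ)

/-- The coefficient of `x ^ n` in the hypergeometric series `₃F₂(a, b, c; d, e; x)`. -/
def coeff3F2 (a b c d e : ℂ) (n : ℕ) : ℂ :=
  poch a n * poch b n * poch c n / (poch d n * poch e n * (n.factorial : ℂ))

/-- The modular invariant `j = E₄³ / Δ`, with `Δ = η²⁴`. -/
def j (τ : ℍ) : ℂ := E₄ τ ^ 3 / discriminant τ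

/-- `J₁ = j / 1728`. -/
def J₁ (τ : ℍ) : ℂ := j τ / 1728

/-- The nonholomorphic Eisenstein series `E₂* = E₂ - 3 / (π Im τ)`. -/
def E₂star (τ : ℍ) : ℂ := EisensteinSeries.E2 τ - 3 / ((Real.pi : ℂ) * (τ.im : ℂ))

end Chudnovsky

end

/-! Write `D` for `q d/dq`. Level-one cusp forms of weight below 12 vanish, which gives Ramanujan's
formulas for `D E2`, `D E₄`, `D E₆` (`normalizedDeriv_E2`, `normalizedDeriv_E₄`,
`normalizedDeriv_E₆`). Since `1728 Δ = E₄³ - E₆²`, the function `x = 1 / J₁ = 1 - E₆² / E₄³` is a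
local coordinate at `q = 0`, and `D x = x E₆ / E₄`; hence `θ = x d/dx` is `(E₄ / E₆) D`. For `f =
E₄^(1/2)` and `p = E2 E₄ / E₆` this yields `θ f = f (p - 1) / 6` and a Riccati equation for `p` over
the rational functions of `x`. Eliminating `p` leaves the third-order hypergeometric equation
(`hypergeometric_of_system`), whose analytic solution with value 1 at 0 is unique
(`taylorCoeff_eq_coeff3F2`). The second series is `6 θ f + (1 - E₂* E₄ / E₆) f = f (E2 - E₂*) E₄ /
E₆`, and `E2 - E₂* = 3 / (π Im τ)`. -/

namespace Chudnovsky

open Filter Function EisensteinSeries Derivative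
open scoped Topology Manifold MatrixGroups

/-! ### Periodic functions in the coordinate `q`. -/

section PeriodicFunctions

variable {F : ℍ → ℂ}

/-- In the coordinate `q`, the normalized derivative is the Euler operator `q d/dq`. -/
lemma normalizedDeriv_eq_qParam_mul_deriv (hper : Periodic (F ∘ ofComplex) (1 : ℝ))
    (hF : MDiff F) (hbdd : IsBoundedAtImInfty F) (τ : ℍ) :
    normalizedDerivOfComplex F τ =
      Periodic.qParam 1 τ * deriv (cuspFunction 1 F) (Periodic.qParam 1 τ) := by
  have hcomp : F ∘ ofComplex = fun z : ℂ ↦ cuspFunction 1 F (Periodic.qParam 1 z) := by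
    funext z
    exact (Periodic.eq_cuspFunction one_ne_zero hper z).symm
  have hq : HasDerivAt (Periodic.qParam 1)
      (2 * Real.pi * Complex.I * Periodic.qParam 1 τ) (τ : ℂ) := by
    have h := (((hasDerivAt_id (τ : ℂ)).const_mul (2 * (Real.pi : ℂ) * Complex.I)).div_const
      ((1 : ℝ) : ℂ)).cexp
    refine h.congr_deriv ?_
    simp only [Periodic.qParam, id_eq, Complex.ofReal_one, div_one]
    ring
  have hc := (differentiableAt_cuspFunction one_pos hper hF hbdd
    (Periodic.norm_qParam_lt_one one_pos τ.im_pos)).hasDerivAt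
  have hderiv : deriv (F ∘ ofComplex) (τ : ℂ) = deriv (cuspFunction 1 F) (Periodic.qParam 1 τ) *
      (2 * Real.pi * Complex.I * Periodic.qParam 1 τ) := by
    rw [hcomp]
    exact (hc.comp (τ : ℂ) hq).deriv
  rw [normalizedDerivOfComplex, hderiv]
  have := Complex.two_pi_I_ne_zero
  field_simp

lemma tendsto_atImInfty_cuspFunction_zero (hper : Periodic (F ∘ ofComplex) (1 : ℝ))
    (hF : MDiff F) (hbdd : IsBoundedAtImInfty F) :
    Tendsto F atImInfty (𝓝 (cuspFunction 1 F 0)) := by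
  refine ((analyticAt_cuspFunction_zero one_pos hper hF hbdd).continuousAt.tendsto.comp
    (qParam_tendsto_atImInfty one_pos)).congr fun τ ↦ ?_
  exact eq_cuspFunction τ one_ne_zero hper

lemma tendsto_normalizedDeriv_atImInfty (hper : Periodic (F ∘ ofComplex) (1 : ℝ))
    (hF : MDiff F) (hbdd : IsBoundedAtImInfty F) :
    Tendsto (normalizedDerivOfComplex F) atImInfty (𝓝 0) := by
  have hq := qParam_tendsto_atImInfty one_pos
  have h := hq.mul ((analyticAt_cuspFunction_zero one_pos hper hF
    hbdd).deriv.continuousAt.tendsto.comp hq)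
  rw [zero_mul] at h
  exact h.congr fun τ ↦ (normalizedDeriv_eq_qParam_mul_deriv hper hF hbdd τ).symm

end PeriodicFunctions

/-! ### The quasimodular form `E2`. -/

section EisensteinTwo

/-- As `E2` is not modular, its periodicity is read off the `q`-expansion. -/
lemma periodic_E2 : Periodic (E2 ∘ ofComplex) (1 : ℝ) := by
  intro w
  by_cases! hw : 0 < w.im
  · have hw' : 0 < (w + (1 : ℝ)).im := by simpa using hw
    simp only [comp_apply, ofComplex_apply_of_im_pos hw', ofComplex_apply_of_im_pos hw]
    refine (hasSum_qExpansion_E2 _).unique ?_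
    convert hasSum_qExpansion_E2 (⟨w, hw⟩ : ℍ) using 4
    simp [mul_add, Complex.exp_add]
  -- Off the upper half-plane `ofComplex` has a constant default value.
  · have hw' : (w + (1 : ℝ)).im ≤ 0 := by simpa using hw
    simp only [comp_apply, ofComplex_apply_of_im_nonpos hw', ofComplex_apply_of_im_nonpos hw]

lemma cuspFunction_E2_zero : cuspFunction 1 E2 0 = 1 := by
  have h := hasFPowerSeriesOnBall_cuspFunction one_pos (f := E2)
    (c := fun m ↦ if m = 0 then 1 else -24 * (ArithmeticFunction.sigma 1 m : ℂ))
    (analyticAt_cuspFunction_zero one_pos periodic_E2 E2_mdifferentiable isBoundedAtImInfty_E2)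
    (fun τ ↦ by
      simpa only [Periodic.qParam, Complex.ofReal_one, div_one] using hasSum_qExpansion_E2 τ)
  simpa using (h.coeff_zero (fun _ ↦ 0)).symm

lemma tendsto_E2_atImInfty : Tendsto E2 atImInfty (𝓝 1) :=
  cuspFunction_E2_zero ▸
    tendsto_atImInfty_cuspFunction_zero periodic_E2 E2_mdifferentiable isBoundedAtImInfty_E2

/-- The quasimodular form `D E₂ - E₂² / 12` transforms like a modular form of weight `4`. -/
lemma normalizedDeriv_E2_sub_sq_slash (γ : SL(2, ℤ)) :
    (normalizedDerivOfComplex E2 - (12⁻¹ : ℂ) • (E2 * E2)) ∣[(4 : ℤ)] γ =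
      normalizedDerivOfComplex E2 - (12⁻¹ : ℂ) • (E2 * E2) := by
  ext z
  have hz : denom γ z ≠ 0 := denom_ne_zero γ z
  have hE : ∀ w : ℍ, (E2 ∣[(2 : ℤ)] γ) w =
      E2 w - 1 / (2 * riemannZeta 2) * D2 γ w := fun w ↦ by simp [E2_slash_action]
  have hD := congrFun (normalizedDerivOfComplex_SL_slash (k := 2) E2_mdifferentiable (γ := γ)) z
  -- The slash of `E2` differs from `E2` by a multiple of `c / (cτ + d)`; this anomaly is
  -- differentiated explicitly.
  have hL : normalizedDerivOfComplex (E2 ∣[(2 : ℤ)] γ) z = normalizedDerivOfComplex E2 z +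
      (2 * Real.pi * Complex.I)⁻¹ * (1 / (2 * riemannZeta 2) * (2 * Real.pi * Complex.I *
        (γ 1 0 : ℂ) * ((γ 1 0 : ℂ) * (denom γ z ^ 2)⁻¹))) := by
    have h1 : HasDerivAt (fun w ↦ (denom γ w) ^ (-1 : ℤ))
        (-(γ 1 0 : ℂ) * (denom γ z ^ 2)⁻¹) (z : ℂ) := by
      have := hasDerivAt_denom_zpow (γ : GL (Fin 2) ℝ) (-1) z
      convert this using 1
      simp
    have h2 := (mdifferentiableAt_iff.mp (E2_mdifferentiable z)).hasDerivAt.sub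
      (h1.const_mul (1 / (2 * riemannZeta 2) * (2 * Real.pi * Complex.I * (γ 1 0 : ℂ))))
    have h3 : (E2 ∣[(2 : ℤ)] γ) ∘ ofComplex =ᶠ[𝓝 (z : ℂ)] (E2 ∘ ofComplex - fun w ↦
        1 / (2 * riemannZeta 2) * (2 * Real.pi * Complex.I * (γ 1 0 : ℂ)) *
          (denom γ w) ^ (-1 : ℤ)) := by
      filter_upwards [isOpen_upperHalfPlaneSet.mem_nhds z.im_pos] with w hw
      rw [comp_apply, hE (ofComplex w)]
      show _ = E2 (ofComplex w) - 1 / (2 * riemannZeta 2) * (2 * Real.pi * Complex.I * (γ 1 0 : ℂ))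
        * (denom γ w) ^ (-1 : ℤ)
      rw [D2, ofComplex_apply_of_im_pos hw, zpow_neg_one]
      ring
    rw [normalizedDerivOfComplex, (h2.congr_of_eventuallyEq h3).deriv, normalizedDerivOfComplex]
    ring
  simp only [hL, Pi.sub_apply, hE z, show (2 : ℤ) + 2 = 4 from rfl] at hD
  have hmul := congrFun (ModularForm.mul_slash_SL2 2 2 γ E2 E2) z
  simp only [show (2 : ℤ) + 2 = 4 from rfl] at hmul
  rw [sub_eq_add_neg, SlashAction.add_slash, SlashAction.neg_slash, ModularForm.SL_smul_slash]
  simp only [Pi.add_apply, Pi.neg_apply, Pi.smul_apply, smul_eq_mul, hmul, hE z, Pi.mul_apply]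
  rw [sub_eq_iff_eq_add.mp hD.symm]
  -- The value `ζ(2) = π² / 6` makes the anomalies of `D E2` and `E2² / 12` cancel.
  simp only [D2, riemannZeta_two]
  have hpi : (Real.pi : ℂ) ≠ 0 := by exact_mod_cast Real.pi_ne_zero
  have hI := Complex.I_ne_zero
  push_cast
  field_simp
  linear_combination (24 * (γ 1 0 : ℂ) * Real.pi * denom γ z * E2 z -
    72 * Complex.I * (γ 1 0 : ℂ) ^ 2) * Complex.I_sq

end EisensteinTwo

/-! ### Ramanujan's differential equations. -/

section Ramanujan

/-- A holomorphic function on `ℍ` of weight `k < 12` and level one that vanishes at the cusp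
is zero. -/
lemma eq_zero_of_weight_lt_twelve {k : ℤ} (hk : k < 12) {g : ℍ → ℂ} (hg : MDiff g)
    (hslash : ∀ γ : SL(2, ℤ), g ∣[k] γ = g) (hzero : Tendsto g atImInfty (𝓝 0)) : g = 0 := by
  let f : CuspForm 𝒮ℒ k :=
    { toFun := g
      slash_action_eq' := by
        rintro A ⟨A, rfl⟩
        exact hslash A
      holo' := hg
      zero_at_cusps' := by
        intro c hc
        -- All cusps are equivalent under `SL(2, ℤ)` and `g` is invariant, so the limit at infinity
        -- suffices.
        rw [Subgroup.IsArithmetic.isCusp_iff_isCusp_SL2Z] at hc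
        rw [OnePoint.isZeroAt_iff_forall_SL2Z hc]
        intro γ _
        rw [hslash]
        exact hzero }
  have hf : f = 0 := rank_zero_iff_forall_zero.mp (CuspForm.rank_eq_zero_of_weight_lt_twelve hk) f
  exact congrArg DFunLike.coe hf

variable {k : ℤ} (f : ModularForm 𝒮ℒ k)

lemma modularForm_slash (γ : SL(2, ℤ)) : (f : ℍ → ℂ) ∣[k] γ = f :=
  SlashInvariantFormClass.slash_action_eq f _ ⟨γ, rfl⟩

lemma periodic_modularForm : Periodic (f ∘ ofComplex) (1 : ℝ) :=
  SlashInvariantFormClass.periodic_comp_ofComplex f one_mem_strictPeriods_SL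

lemma isBoundedAtImInfty_modularForm : IsBoundedAtImInfty f :=
  have : Fact (IsCusp OnePoint.infty 𝒮ℒ) :=
    ⟨Subgroup.isCusp_of_mem_strictPeriods one_pos one_mem_strictPeriods_SL⟩
  ModularFormClass.bdd_at_infty f

lemma tendsto_modularForm_atImInfty : Tendsto f atImInfty (𝓝 (cuspFunction 1 f 0)) :=
  tendsto_atImInfty_cuspFunction_zero (periodic_modularForm f) (ModularFormClass.holo f)
    (isBoundedAtImInfty_modularForm f)

lemma cuspFunction_E_zero {k : ℕ} (hk : 3 ≤ k) (hk2 : Even k) :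
    cuspFunction 1 (ModularForm.E hk) 0 = 1 := by
  have h := EisensteinSeries.E_qExpansion_coeff_zero hk hk2
  simpa [qExpansion_coeff] using h

lemma serreDerivative_modularForm_slash (γ : SL(2, ℤ)) :
    serreDerivative k f ∣[k + 2] γ = serreDerivative k f :=
  serreDerivative_slash_invariant (ModularFormClass.holo f) (modularForm_slash f γ)

lemma tendsto_serreDerivative_atImInfty :
    Tendsto (serreDerivative k f) atImInfty (𝓝 (-(k / 12 * cuspFunction 1 f 0))) := by
  have h := (tendsto_normalizedDeriv_atImInfty (periodic_modularForm f) (ModularFormClass.holo f)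
    (isBoundedAtImInfty_modularForm f)).sub
    ((tendsto_E2_atImInfty.const_mul ((k : ℂ) * 12⁻¹)).mul (tendsto_modularForm_atImInfty f))
  rw [show -((k : ℂ) / 12 * cuspFunction 1 f 0) =
    0 - (k : ℂ) * 12⁻¹ * 1 * cuspFunction 1 f 0 by ring]
  exact h

/-- The Serre derivative has weight 6 and constant term `-1/3`, so adding `E₆ / 3` makes it vanish
at the cusp. The next two formulas follow the same pattern in weights 8 and 4. -/
theorem normalizedDeriv_E₄ (τ : ℍ) :
    normalizedDerivOfComplex E₄ τ = (E2 τ * E₄ τ - E₆ τ) / 3 := by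
  have h : serreDerivative (4 : ℤ) E₄ + (3⁻¹ : ℂ) • (E₆ : ℍ → ℂ) = 0 := by
    refine eq_zero_of_weight_lt_twelve (k := 6) (by norm_num)
      ((serreDerivative_mdifferentiable _ (ModularFormClass.holo E₄)).add
        ((ModularFormClass.holo E₆).const_smul _)) (fun γ ↦ ?_) ?_
    · rw [SlashAction.add_slash, ModularForm.SL_smul_slash]
      exact congrArg₂ _ (serreDerivative_modularForm_slash E₄ γ)
        (congrArg _ (modularForm_slash E₆ γ))
    · have := (tendsto_serreDerivative_atImInfty E₄).add
        ((tendsto_modularForm_atImInfty E₆).const_smul (3⁻¹ : ℂ))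
      rw [cuspFunction_E_zero _ ⟨2, rfl⟩, cuspFunction_E_zero _ ⟨3, rfl⟩] at this
      rw [show (0 : ℂ) = -(((4 : ℤ) : ℂ) / 12 * 1) + (3⁻¹ : ℂ) • 1 by norm_num]
      exact this
  have := congrFun h τ
  simp only [Pi.add_apply, serreDerivative_apply, Pi.smul_apply, smul_eq_mul, Pi.zero_apply] at this
  push_cast at this
  linear_combination this

theorem normalizedDeriv_E₆ (τ : ℍ) :
    normalizedDerivOfComplex E₆ τ = (E2 τ * E₆ τ - E₄ τ ^ 2) / 2 := by
  have h : serreDerivative (6 : ℤ) E₆ + (2⁻¹ : ℂ) • ((E₄ : ℍ → ℂ) * E₄) = 0 := by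
    refine eq_zero_of_weight_lt_twelve (k := 8) (by norm_num)
      ((serreDerivative_mdifferentiable _ (ModularFormClass.holo E₆)).add
        (((ModularFormClass.holo E₄).mul (ModularFormClass.holo E₄)).const_smul _)) (fun γ ↦ ?_) ?_
    · rw [SlashAction.add_slash, ModularForm.SL_smul_slash]
      refine congrArg₂ _ (serreDerivative_modularForm_slash E₆ γ) (congrArg _ ?_)
      refine (ModularForm.mul_slash_SL2 4 4 γ E₄ E₄).trans ?_
      exact congrArg₂ _ (modularForm_slash E₄ γ) (modularForm_slash E₄ γ)
    · have := (tendsto_serreDerivative_atImInfty E₆).add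
        (((tendsto_modularForm_atImInfty E₄).mul
          (tendsto_modularForm_atImInfty E₄)).const_smul (2⁻¹ : ℂ))
      rw [cuspFunction_E_zero _ ⟨2, rfl⟩, cuspFunction_E_zero _ ⟨3, rfl⟩] at this
      rw [show (0 : ℂ) = -(((6 : ℤ) : ℂ) / 12 * 1) + (2⁻¹ : ℂ) • (1 * 1) by norm_num]
      exact this
  have := congrFun h τ
  simp only [Pi.add_apply, serreDerivative_apply, Pi.smul_apply, smul_eq_mul, Pi.zero_apply,
    Pi.mul_apply] at this
  push_cast at this
  linear_combination this

theorem normalizedDeriv_E2 (τ : ℍ) :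
    normalizedDerivOfComplex E2 τ = (E2 τ ^ 2 - E₄ τ) / 12 := by
  have h : normalizedDerivOfComplex E2 - (12⁻¹ : ℂ) • (E2 * E2) + (12⁻¹ : ℂ) • (E₄ : ℍ → ℂ) = 0 := by
    refine eq_zero_of_weight_lt_twelve (k := 4) (by norm_num)
      (((normalizedDerivOfComplex_mdifferentiable E2_mdifferentiable).sub
        ((E2_mdifferentiable.mul E2_mdifferentiable).const_smul _)).add
        ((ModularFormClass.holo E₄).const_smul _)) (fun γ ↦ ?_) ?_
    · rw [SlashAction.add_slash, ModularForm.SL_smul_slash]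
      exact congrArg₂ _ (normalizedDeriv_E2_sub_sq_slash γ)
        (congrArg _ (modularForm_slash E₄ γ))
    · have := ((tendsto_normalizedDeriv_atImInfty periodic_E2 E2_mdifferentiable
        isBoundedAtImInfty_E2).sub
        ((tendsto_E2_atImInfty.mul tendsto_E2_atImInfty).const_smul (12⁻¹ : ℂ))).add
        ((tendsto_modularForm_atImInfty E₄).const_smul (12⁻¹ : ℂ))
      rw [cuspFunction_E_zero _ ⟨2, rfl⟩] at this
      rw [show (0 : ℂ) = 0 - (12⁻¹ : ℂ) • (1 * 1) + (12⁻¹ : ℂ) • 1 by norm_num]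
      exact this
  have := congrFun h τ
  simp only [Pi.add_apply, Pi.sub_apply, Pi.smul_apply, smul_eq_mul, Pi.zero_apply,
    Pi.mul_apply] at this
  linear_combination this

end Ramanujan

/-! ### The Euler operator on Taylor series. -/

section EulerOperator

/-- The Euler operator `x d/dx`. -/
noncomputable def euler (f : ℂ → ℂ) (x : ℂ) : ℂ := x * deriv f x

lemma analyticAt_euler {f : ℂ → ℂ} (hf : AnalyticAt ℂ f 0) : AnalyticAt ℂ (euler f) 0 :=
  analyticAt_id.mul hf.deriv

lemma euler_congr {f g : ℂ → ℂ} (h : f =ᶠ[𝓝 0] g) : euler f =ᶠ[𝓝 0] euler g := by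
  filter_upwards [h.deriv] with x hx
  rw [euler, euler, hx]

/-- At 0 only the Leibniz term differentiating `x` exactly once survives. For `n = 0` the truncated
`n - 1` is multiplied by 0. -/
lemma iteratedDeriv_id_mul_zero {g : ℂ → ℂ} (hg : AnalyticAt ℂ g 0) (n : ℕ) :
    iteratedDeriv n (fun x ↦ x * g x) 0 = n * iteratedDeriv (n - 1) g 0 := by
  rw [iteratedDeriv_fun_mul contDiffAt_fun_id hg.contDiffAt]
  rcases n with _ | n
  · simp
  rw [Finset.sum_eq_single 1]
  · simp
  · intro i _ hi
    rcases i with _ | _ | i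
    · simp
    · exact absurd rfl hi
    · simp [iteratedDeriv_succ', iteratedDeriv_const]
  · simp

lemma iteratedDeriv_euler_zero {f : ℂ → ℂ} (hf : AnalyticAt ℂ f 0) (n : ℕ) :
    iteratedDeriv n (euler f) 0 = n * iteratedDeriv n f 0 := by
  refine (iteratedDeriv_id_mul_zero hf.deriv n).trans ?_
  rcases n with _ | n
  · simp
  · simp [iteratedDeriv_succ']

/-- The Taylor series of a function analytic at `0` sums to it near `0`. -/
lemma eventually_hasSum_taylor {f : ℂ → ℂ} (hf : AnalyticAt ℂ f 0) :
    ∀ᶠ x in 𝓝 0, HasSum (fun n : ℕ ↦ iteratedDeriv n f 0 / n.factorial * x ^ n) (f x) := by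
  obtain ⟨r, hr, h⟩ := Metric.eventually_nhds_iff_ball.mp hf.eventually_analyticAt
  filter_upwards [Metric.ball_mem_nhds (0 : ℂ) hr] with x hx
  have hsum := Complex.hasSum_taylorSeries_on_ball (f := f)
    (fun y hy ↦ (h y hy).differentiableAt.differentiableWithinAt) hx
  simp only [sub_zero, smul_eq_mul] at hsum
  refine hsum.congr_fun fun n ↦ ?_
  ring

end EulerOperator

/-! ### The hypergeometric equation. -/

section Hypergeometric

/-- The recurrence for the coefficients of `₃F₂(1/2, 1/6, 5/6; 1, 1; x)`. -/
lemma coeff3F2_succ (n : ℕ) :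
    ((n : ℂ) + 1) ^ 3 * coeff3F2 (1 / 2) (1 / 6) (5 / 6) 1 1 (n + 1) =
      ((n : ℂ) + 1 / 2) * (n + 1 / 6) * (n + 5 / 6) * coeff3F2 (1 / 2) (1 / 6) (5 / 6) 1 1 n := by
  have h1 : (n : ℂ) + 1 ≠ 0 := Nat.cast_add_one_ne_zero n
  have h2 : (n.factorial : ℂ) ≠ 0 := Nat.cast_ne_zero.mpr n.factorial_ne_zero
  simp only [coeff3F2, poch, ascPochhammer_succ_eval, ascPochhammer_eval_one, Nat.factorial_succ,
    Nat.cast_mul, Nat.cast_add, Nat.cast_one]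
  rw [← mul_div_assoc, ← mul_div_assoc,
    div_eq_div_iff (by simp [h1, h2, add_comm (1 : ℂ)]) (by simp [h2])]
  ring

/-- The solution of the hypergeometric equation that is analytic at `0`. -/
lemma taylorCoeff_eq_coeff3F2 {f : ℂ → ℂ} (hf : AnalyticAt ℂ f 0) (h0 : f 0 = 1)
    (hode : ∀ᶠ x in 𝓝 0, euler (euler (euler f)) x = x * (euler (euler (euler f)) x +
      3 / 2 * euler (euler f) x + 23 / 36 * euler f x + 5 / 72 * f x)) (n : ℕ) :
    iteratedDeriv n f 0 / n.factorial = coeff3F2 (1 / 2) (1 / 6) (5 / 6) 1 1 n := by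
  have h1 := analyticAt_euler hf
  have h2 := analyticAt_euler h1
  have h3 := analyticAt_euler h2
  induction n with
  | zero => simp [h0, coeff3F2, poch]
  | succ n ih =>
    have hc : (n : ℂ) + 1 ≠ 0 := Nat.cast_add_one_ne_zero n
    have hfac : (n.factorial : ℂ) ≠ 0 := Nat.cast_ne_zero.mpr n.factorial_ne_zero
    -- Comparing coefficients of `x ^ (n + 1)` recovers the recurrence, because `(n + 1/2)(n +
    -- 1/6)(n + 5/6) = n³ + 3/2 n² + 23/36 n + 5/72`; its leading factor `(n + 1)³` never vanishes.
    have hrec := EventuallyEq.iteratedDeriv_eq (n + 1) hode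
    have ha2 : AnalyticAt ℂ (fun x ↦ 3 / 2 * euler (euler f) x) 0 := analyticAt_const.mul h2
    have ha1 : AnalyticAt ℂ (fun x ↦ 23 / 36 * euler f x) 0 := analyticAt_const.mul h1
    have ha0 : AnalyticAt ℂ (fun x ↦ 5 / 72 * f x) 0 := analyticAt_const.mul hf
    have hs2 := h3.fun_add ha2
    have hs1 := hs2.fun_add ha1
    rw [iteratedDeriv_id_mul_zero (hs1.fun_add ha0),
      iteratedDeriv_fun_add hs1.contDiffAt ha0.contDiffAt,
      iteratedDeriv_fun_add hs2.contDiffAt ha1.contDiffAt,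
      iteratedDeriv_fun_add h3.contDiffAt ha2.contDiffAt,
      iteratedDeriv_const_mul_field, iteratedDeriv_const_mul_field, iteratedDeriv_const_mul_field]
      at hrec
    simp only [iteratedDeriv_euler_zero h2, iteratedDeriv_euler_zero h1,
      iteratedDeriv_euler_zero hf, Nat.add_sub_cancel] at hrec
    rw [div_eq_iff hfac] at ih
    rw [ih] at hrec
    have hsucc := coeff3F2_succ n
    rw [Nat.factorial_succ, div_eq_iff (by push_cast; positivity)]
    apply mul_left_cancel₀ (pow_ne_zero 3 hc)
    push_cast at hrec ⊢
    linear_combination hrec - (n + 1) * n.factorial * hsucc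

/-- A first-order system equivalent to the hypergeometric equation. -/
lemma hypergeometric_of_system {f p : ℂ → ℂ} (hf : AnalyticAt ℂ f 0) (hp : AnalyticAt ℂ p 0)
    (hef : ∀ᶠ x in 𝓝 0, euler f x = f x * (p x - 1) / 6)
    (hep : ∀ᶠ x in 𝓝 0, (1 - x) * euler p x =
      (1 - x) * (-p x ^ 2 / 12 - p x / 3) - 1 / 12 + p x / 2) :
    ∀ᶠ x in 𝓝 0, euler (euler (euler f)) x = x * (euler (euler (euler f)) x +
      3 / 2 * euler (euler f) x + 23 / 36 * euler f x + 5 / 72 * f x) := by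
  have hprod : ∀ {u v : ℂ → ℂ}, AnalyticAt ℂ u 0 → AnalyticAt ℂ v 0 →
      ∀ᶠ x in 𝓝 0, euler (fun y ↦ u y * v y) x = euler u x * v x + u x * euler v x := by
    intro u v hu hv
    filter_upwards [hu.eventually_analyticAt, hv.eventually_analyticAt] with x hux hvx
    rw [euler, deriv_fun_mul hux.differentiableAt hvx.differentiableAt, euler, euler]
    ring
  have hp1 := analyticAt_euler hp
  have hg : AnalyticAt ℂ (fun x ↦ (p x - 1) / 6) 0 := by fun_prop
  have heg : ∀ᶠ x in 𝓝 0, euler (fun x ↦ (p x - 1) / 6) x = euler p x / 6 := by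
    filter_upwards with x
    simp [euler, mul_div_assoc]
  have heg1 : ∀ᶠ x in 𝓝 0, euler (fun x ↦ euler p x / 6) x = euler (euler p) x / 6 := by
    filter_upwards with x
    rw [euler, deriv_div_const, euler, mul_div_assoc]
  have e1 : euler f =ᶠ[𝓝 0] fun x ↦ f x * ((p x - 1) / 6) := by
    filter_upwards [hef] with x hx
    rw [hx]; ring
  -- With `g = θf / f = (p - 1) / 6`, one has `θ²f = f (g² + θg)` and `θ³f = f (g³ + 3 g θg + θ²g)`.
  have e2 : euler (euler f) =ᶠ[𝓝 0]
      fun x ↦ f x * (((p x - 1) / 6) * ((p x - 1) / 6) + euler p x / 6) := by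
    filter_upwards [euler_congr e1, hprod hf hg, heg, e1] with x h1 h2 h3 h4
    rw [h1, h2, h3, h4]; ring
  have e3 : euler (euler (euler f)) =ᶠ[𝓝 0] fun x ↦ f x * (((p x - 1) / 6) ^ 3 +
      3 * ((p x - 1) / 6) * (euler p x / 6) + euler (euler p) x / 6) := by
    have hgg := hg.fun_mul hg
    have hq : AnalyticAt ℂ (fun x ↦ euler p x / 6) 0 := by fun_prop
    have hsum : ∀ᶠ x in 𝓝 0, euler (fun x ↦ ((p x - 1) / 6) * ((p x - 1) / 6) + euler p x / 6) x =
        euler (fun x ↦ ((p x - 1) / 6) * ((p x - 1) / 6)) x + euler (fun x ↦ euler p x / 6) x := by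
      filter_upwards [hgg.eventually_analyticAt, hq.eventually_analyticAt] with x hux hvx
      rw [euler, deriv_fun_add hux.differentiableAt hvx.differentiableAt, euler, euler]
      ring
    filter_upwards [euler_congr e2, hprod hf (hgg.fun_add hq), heg, heg1, e1, hsum,
      hprod hg hg] with x h1 h2 h3 h4 h5 h6 h7
    rw [h1, h2, h6, h7, h3, h4, h5]; ring
  -- The Euler operator applied to the Riccati equation, to express `θ²p`.
  have hpp : ∀ᶠ x in 𝓝 0, (1 - x) * euler (euler p) x - x * euler p x =
      (1 - x) * (-p x * euler p x / 6 - euler p x / 3) - x * (-p x ^ 2 / 12 - p x / 3)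
        + euler p x / 2 := by
    filter_upwards [euler_congr hep, hp.eventually_analyticAt, hp1.eventually_analyticAt]
      with x hx hpx hp1x
    have hl : HasDerivAt (fun y ↦ (1 - y) * euler p y)
        ((-1) * euler p x + (1 - x) * deriv (euler p) x) x :=
      ((hasDerivAt_id x).const_sub 1).mul hp1x.differentiableAt.hasDerivAt
    have hd := hpx.differentiableAt.hasDerivAt
    have hr : HasDerivAt (fun y ↦ (1 - y) * (-p y ^ 2 / 12 - p y / 3) - 1 / 12 + p y / 2)
        ((-1) * (-p x ^ 2 / 12 - p x / 3) +
          (1 - x) * (-(2 * p x * deriv p x) / 12 - deriv p x / 3) + deriv p x / 2) x := by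
      have h2 := (((hd.pow 2).neg.div_const 12).sub (hd.div_const 3))
      have := (((((hasDerivAt_id x).const_sub 1).mul h2).sub_const (1 / 12)).add
        (hd.div_const 2))
      refine this.congr_deriv ?_
      simp
    rw [euler, euler, hl.deriv, hr.deriv] at hx
    rw [euler, euler] at *
    linear_combination hx
  filter_upwards [e1, e2, e3, hep, hpp] with x h1 h2 h3 h4 h5
  rw [h3, h2, h1]
  linear_combination (f x / 6) * h5 + f x * (p x - 1) / 18 * h4

end Hypergeometric

/-! ### From the Ramanujan system to hypergeometric series. -/

section RamanujanSystem

variable {e2 e4 e6 : ℂ → ℂ}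

/-- If analytic functions `e2, e4, e6` of `q` with value `1` at `0` satisfy the Ramanujan system,
then `e4 ^ (1 / 2)` and its logarithmic derivative are hypergeometric series in the variable
`1 - e6 ^ 2 / e4 ^ 3`, provided that this is a local coordinate at `0`. -/
theorem eventually_hasSum_of_ramanujan (h2 : AnalyticAt ℂ e2 0) (h4 : AnalyticAt ℂ e4 0)
    (h6 : AnalyticAt ℂ e6 0) (h40 : e4 0 = 1) (h60 : e6 0 = 1)
    (hr2 : ∀ᶠ q in 𝓝 0, euler e2 q = (e2 q ^ 2 - e4 q) / 12)
    (hr4 : ∀ᶠ q in 𝓝 0, euler e4 q = (e2 q * e4 q - e6 q) / 3)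
    (hr6 : ∀ᶠ q in 𝓝 0, euler e6 q = (e2 q * e6 q - e4 q ^ 2) / 2)
    (hw' : deriv (fun q ↦ 1 - e6 q ^ 2 / e4 q ^ 3) 0 ≠ 0) :
    ∀ᶠ q in 𝓝 0,
      HasSum (fun n : ℕ ↦ coeff3F2 (1 / 2) (1 / 6) (5 / 6) 1 1 n *
        (1 - e6 q ^ 2 / e4 q ^ 3) ^ n) (e4 q ^ (1 / 2 : ℂ)) ∧
      HasSum (fun n : ℕ ↦ n * coeff3F2 (1 / 2) (1 / 6) (5 / 6) 1 1 n *
        (1 - e6 q ^ 2 / e4 q ^ 3) ^ n)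
        (e4 q ^ (1 / 2 : ℂ) * (e2 q * e4 q / e6 q - 1) / 6) := by
  set w : ℂ → ℂ := fun q ↦ 1 - e6 q ^ 2 / e4 q ^ 3 with hw_def
  have hw : AnalyticAt ℂ w 0 :=
    analyticAt_const.fun_sub ((h6.fun_pow 2).fun_div (h4.fun_pow 3) (by simp [h40]))
  have hw0 : w 0 = 0 := by simp [hw_def, h40, h60]
  have h4ne : ∀ᶠ q in 𝓝 0, e4 q ∈ Complex.slitPlane :=
    h4.continuousAt.eventually_mem (Complex.isOpen_slitPlane.mem_nhds (by simp [h40]))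
  have h6ne : ∀ᶠ q in 𝓝 0, e6 q ≠ 0 := h6.continuousAt.eventually_ne (by simp [h60])
  have hd4 := h4.eventually_analyticAt
  have hd6 := h6.eventually_analyticAt
  -- the Euler derivatives with respect to `q`
  have hew : ∀ᶠ q in 𝓝 0, euler w q = w q * (e6 q / e4 q) := by
    filter_upwards [h4ne, hd4, hd6, hr4, hr6] with q hs a4 a6 r4 r6
    have hne := Complex.slitPlane_ne_zero hs
    have hd := ((a6.differentiableAt.hasDerivAt.pow 2).div (a4.differentiableAt.hasDerivAt.pow 3)
      (pow_ne_zero 3 hne)).const_sub 1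
    rw [euler] at r4 r6 ⊢
    rw [show deriv w q = _ from hd.deriv]
    simp only [hw_def, Pi.pow_apply]
    field_simp
    push_cast
    linear_combination (-2 * e6 q * e4 q ^ 3) * r6 + 3 * e6 q ^ 2 * e4 q ^ 2 * r4
  set f : ℂ → ℂ := fun q ↦ e4 q ^ (1 / 2 : ℂ) with hf_def
  have hf : AnalyticAt ℂ f 0 := h4.cpow analyticAt_const (by simp [h40])
  have hef : ∀ᶠ q in 𝓝 0, euler f q * (e4 q / e6 q) =
      f q * (e2 q * e4 q / e6 q - 1) / 6 := by
    filter_upwards [h4ne, h6ne, hd4, hr4] with q hs h6q a4 r4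
    have hne := Complex.slitPlane_ne_zero hs
    have hd := a4.differentiableAt.hasDerivAt.cpow_const (c := (1 / 2 : ℂ)) hs
    rw [euler] at r4 ⊢
    rw [show deriv f q = _ from hd.deriv, Complex.cpow_sub _ _ hne, Complex.cpow_one]
    simp only [hf_def]
    field_simp
    linear_combination 6 * e4 q ^ (1 / 2 : ℂ) * r4
  set p : ℂ → ℂ := fun q ↦ e2 q * e4 q / e6 q with hp_def
  have hp : AnalyticAt ℂ p 0 := (h2.fun_mul h4).fun_div h6 (by simp [h60])
  -- Substituting `e6² / e4³ = 1 - w` closes this equation in `p` and `w` alone.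
  have hep : ∀ᶠ q in 𝓝 0, (1 - w q) * (euler p q * (e4 q / e6 q)) =
      (1 - w q) * (-p q ^ 2 / 12 - p q / 3) - 1 / 12 + p q / 2 := by
    filter_upwards [h4ne, h6ne, h2.eventually_analyticAt, hd4, hd6, hr2, hr4, hr6]
      with q hs h6q a2 a4 a6 r2 r4 r6
    have hne := Complex.slitPlane_ne_zero hs
    have hd := (a2.differentiableAt.hasDerivAt.mul a4.differentiableAt.hasDerivAt).div
      a6.differentiableAt.hasDerivAt h6q
    rw [euler] at r2 r4 r6 ⊢
    rw [show deriv p q = _ from hd.deriv]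
    have hkey : q * (((deriv e2 q * e4 q + e2 q * deriv e4 q) * e6 q -
        e2 q * e4 q * deriv e6 q) / e6 q ^ 2) =
        (((e2 q ^ 2 - e4 q) / 12 * e4 q + e2 q * ((e2 q * e4 q - e6 q) / 3)) * e6 q -
        e2 q * e4 q * ((e2 q * e6 q - e4 q ^ 2) / 2)) / e6 q ^ 2 := by
      rw [← r2, ← r4, ← r6]
      ring
    simp only [Pi.mul_apply]
    rw [hkey]
    simp only [hw_def, hp_def]
    field_simp
    ring
  -- transport to the coordinate `w`
  have hst := hw.hasStrictDerivAt
  set s : ℂ → ℂ := hst.localInverse w (deriv w 0) 0 hw' with hs_def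
  have hs : AnalyticAt ℂ s 0 := hw0 ▸ hw.analyticAt_localInverse hw'
  have hleft : ∀ᶠ q in 𝓝 0, s (w q) = q := hst.eventually_left_inverse hw'
  have hright : ∀ᶠ y in 𝓝 0, w (s y) = y := hw0 ▸ hst.eventually_right_inverse hw'
  have hs0 : s 0 = 0 := by simpa [hw0] using hleft.self_of_nhds
  have hst0 : Tendsto s (𝓝 0) (𝓝 0) := by simpa [hs0] using hs.continuousAt.tendsto
  -- By `hew`, the Euler operator in `w` is `e4 / e6` times the one in `q`.
  have hchain : ∀ {u : ℂ → ℂ}, AnalyticAt ℂ u 0 →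
      ∀ᶠ y in 𝓝 0, euler (fun y ↦ u (s y)) y = euler u (s y) * (e4 (s y) / e6 (s y)) := by
    intro u hu
    have hcomp : (fun y ↦ w (s y)) =ᶠ[𝓝 0] id := hright
    filter_upwards [hst0.eventually hu.eventually_analyticAt, hs.eventually_analyticAt,
      hst0.eventually hw.eventually_analyticAt, hcomp.deriv, hright, hst0.eventually hew,
      hst0.eventually h4ne, hst0.eventually h6ne] with y hu' hs' hwy hc hr hE h4y h6y
    have hne := Complex.slitPlane_ne_zero h4y
    have hsd := hs'.differentiableAt.hasDerivAt
    have c1 : deriv (fun y ↦ w (s y)) y = _ :=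
      (hwy.differentiableAt.hasDerivAt.comp y hsd).deriv
    have c2 : deriv (fun y ↦ u (s y)) y = _ :=
      (hu'.differentiableAt.hasDerivAt.comp y hsd).deriv
    rw [hc, deriv_id] at c1
    rw [hr, euler] at hE
    rw [euler, c2, euler]
    have hy : y * deriv s y = s y * (e4 (s y) / e6 (s y)) := by
      field_simp at hE ⊢
      linear_combination -(s y * e4 (s y)) * c1 - deriv s y * hE
    linear_combination deriv u (s y) * hy
  have hfs : AnalyticAt ℂ (fun y ↦ f (s y)) 0 := AnalyticAt.comp (g := f) (by rwa [hs0]) hs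
  have hps : AnalyticAt ℂ (fun y ↦ p (s y)) 0 := AnalyticAt.comp (g := p) (by rwa [hs0]) hs
  have hefs : ∀ᶠ y in 𝓝 0, euler (fun y ↦ f (s y)) y = f (s y) * (p (s y) - 1) / 6 := by
    filter_upwards [hchain hf, hst0.eventually hef] with y h h'
    rw [h, h']
  have heps : ∀ᶠ y in 𝓝 0, (1 - y) * euler (fun y ↦ p (s y)) y =
      (1 - y) * (-p (s y) ^ 2 / 12 - p (s y) / 3) - 1 / 12 + p (s y) / 2 := by
    filter_upwards [hchain hp, hst0.eventually hep, hright] with y h h' hr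
    rw [hr] at h'
    rw [h, h']
  have hcoeff := taylorCoeff_eq_coeff3F2 hfs (by simp [hs0, hf_def, h40])
    (hypergeometric_of_system hfs hps hefs heps)
  have hwt : Tendsto w (𝓝 0) (𝓝 0) := by simpa [hw0] using hw.continuousAt.tendsto
  filter_upwards [hleft, hwt.eventually (eventually_hasSum_taylor hfs),
    hwt.eventually (eventually_hasSum_taylor (analyticAt_euler hfs)), hwt.eventually hefs]
    with q hq t1 t2 he
  rw [he] at t2
  simp only [iteratedDeriv_euler_zero hfs, mul_div_assoc, hcoeff, hq] at t1 t2
  exact ⟨t1, by rw [mul_div_assoc (e4 q ^ (1 / 2 : ℂ))]; exact t2⟩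

end RamanujanSystem

/-! ### Eisenstein series as functions of `q`. -/

section CuspFunctions

lemma exists_qParam_eq {q : ℂ} (hq : ‖q‖ < 1) (hq0 : q ≠ 0) : ∃ τ : ℍ, Periodic.qParam 1 τ = q :=
  ⟨⟨Periodic.invQParam 1 q, Periodic.im_invQParam_pos_of_norm_lt_one one_pos hq hq0⟩,
    Periodic.qParam_right_inv one_ne_zero hq0⟩

/-- A differential equation on `ℍ` in terms of the `q`-coordinate. -/
lemma eventually_euler_cuspFunction {F : ℍ → ℂ} (hper : Periodic (F ∘ ofComplex) (1 : ℝ))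
    (hF : MDiff F) (hbdd : IsBoundedAtImInfty F) {G : ℂ → ℂ} (hG0 : G 0 = 0)
    (hG : ∀ τ : ℍ, normalizedDerivOfComplex F τ = G (Periodic.qParam 1 τ)) :
    ∀ᶠ q in 𝓝 0, euler (cuspFunction 1 F) q = G q := by
  filter_upwards [Metric.ball_mem_nhds (0 : ℂ) one_pos] with q hq
  -- The point `q = 0` comes from no `τ`; there both sides vanish.
  rcases eq_or_ne q 0 with rfl | hq0
  · simp [euler, hG0]
  · obtain ⟨τ, rfl⟩ := exists_qParam_eq (mem_ball_zero_iff.mp hq) hq0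
    rw [← hG τ, normalizedDeriv_eq_qParam_mul_deriv hper hF hbdd, euler]

variable (τ : ℍ)

lemma cuspFunction_E2_qParam : cuspFunction 1 E2 (Periodic.qParam 1 τ) = E2 τ :=
  eq_cuspFunction τ one_ne_zero periodic_E2

lemma cuspFunction_modularForm_qParam {k : ℤ} (f : ModularForm 𝒮ℒ k) :
    cuspFunction 1 f (Periodic.qParam 1 τ) = f τ :=
  eq_cuspFunction τ one_ne_zero (periodic_modularForm f)

lemma analyticAt_cuspFunction_modularForm {k : ℤ} (f : ModularForm 𝒮ℒ k) :
    AnalyticAt ℂ (cuspFunction 1 f) 0 :=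
  analyticAt_cuspFunction_zero one_pos (periodic_modularForm f) (ModularFormClass.holo f)
    (isBoundedAtImInfty_modularForm f)

lemma cuspFunction_E₄_zero : cuspFunction 1 E₄ 0 = 1 := cuspFunction_E_zero _ ⟨2, rfl⟩

lemma cuspFunction_E₆_zero : cuspFunction 1 E₆ 0 = 1 := cuspFunction_E_zero _ ⟨3, rfl⟩

lemma deriv_cuspFunction_E₄_zero : deriv (cuspFunction 1 E₄) 0 = 240 := by
  simpa [qExpansion_coeff] using E₄_qExpansion_coeff_one

lemma deriv_cuspFunction_E₆_zero : deriv (cuspFunction 1 E₆) 0 = -504 := by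
  simpa [qExpansion_coeff] using E₆_qExpansion_coeff_one

/-- The value is `2 * 504 + 3 * 240`; being nonzero, it makes `1 / J₁` a local coordinate at the
cusp. -/
lemma deriv_inv_J₁_coordinate :
    deriv (fun q ↦ 1 - cuspFunction 1 E₆ q ^ 2 / cuspFunction 1 E₄ q ^ 3) 0 = 1728 := by
  have h4 := (analyticAt_cuspFunction_modularForm E₄).differentiableAt.hasDerivAt
  have h6 := (analyticAt_cuspFunction_modularForm E₆).differentiableAt.hasDerivAt
  have h := (((h6.pow 2).div (h4.pow 3) (by simp [cuspFunction_E₄_zero])).const_sub 1).deriv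
  refine Eq.trans h ?_
  simp only [Pi.pow_apply, cuspFunction_E₄_zero, cuspFunction_E₆_zero, deriv_cuspFunction_E₄_zero,
    deriv_cuspFunction_E₆_zero]
  norm_num

end CuspFunctions

/-! ### Expansions in `1 / J₁` near the cusp. -/

section Hypergeometric

lemma R_two_mul_R_six (n : ℕ) : R n 2 * R n 6 = coeff3F2 (1 / 2) (1 / 6) (5 / 6) 1 1 n := by
  have h2 : (Finset.Icc 1 2).filter (fun i => Nat.gcd i 2 = 1) = {1} := by decide
  have h6 : (Finset.Icc 1 6).filter (fun i => Nat.gcd i 6 = 1) = {1, 5} := by decide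
  have hfac : (n.factorial : ℂ) ≠ 0 := Nat.cast_ne_zero.mpr n.factorial_ne_zero
  have h1 : poch 1 n = n.factorial := ascPochhammer_eval_one ℂ n
  rw [R, R, h2, h6, Finset.prod_singleton, Finset.prod_pair (by norm_num), coeff3F2, h1]
  push_cast
  field_simp

lemma one_div_J₁ {τ : ℍ} (h : E₄ τ ≠ 0) : 1 / J₁ τ = 1 - E₆ τ ^ 2 / E₄ τ ^ 3 := by
  rw [J₁, j, discriminant_eq_E₄_cube_sub_E₆_sq]
  field_simp

lemma J₁_ne_zero {τ : ℍ} (h : E₄ τ ≠ 0) : J₁ τ ≠ 0 :=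
  div_ne_zero (div_ne_zero (pow_ne_zero 3 h) (discriminant_ne_zero τ)) (by norm_num)

/-- The hypergeometric expansions of `E₄ ^ (1 / 2)` and of its logarithmic derivative with
respect to `1 / J₁`, near the cusp. -/
theorem eventually_hasSum_atImInfty : ∀ᶠ τ : ℍ in atImInfty,
    HasSum (fun n : ℕ ↦ coeff3F2 (1 / 2) (1 / 6) (5 / 6) 1 1 n *
      (1 - E₆ τ ^ 2 / E₄ τ ^ 3) ^ n) (E₄ τ ^ (1 / 2 : ℂ)) ∧
    HasSum (fun n : ℕ ↦ n * coeff3F2 (1 / 2) (1 / 6) (5 / 6) 1 1 n *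
      (1 - E₆ τ ^ 2 / E₄ τ ^ 3) ^ n)
      (E₄ τ ^ (1 / 2 : ℂ) * (E2 τ * E₄ τ / E₆ τ - 1) / 6) := by
  have hr2 := eventually_euler_cuspFunction periodic_E2 E2_mdifferentiable isBoundedAtImInfty_E2
    (G := fun q ↦ (cuspFunction 1 E2 q ^ 2 - cuspFunction 1 E₄ q) / 12)
    (by simp [cuspFunction_E2_zero, cuspFunction_E₄_zero]) (fun τ ↦ by
      simp only [cuspFunction_E2_qParam, cuspFunction_modularForm_qParam, normalizedDeriv_E2])
  have hr4 := eventually_euler_cuspFunction (periodic_modularForm E₄) (ModularFormClass.holo E₄)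
    (isBoundedAtImInfty_modularForm E₄)
    (G := fun q ↦ (cuspFunction 1 E2 q * cuspFunction 1 E₄ q - cuspFunction 1 E₆ q) / 3)
    (by simp [cuspFunction_E2_zero, cuspFunction_E₄_zero, cuspFunction_E₆_zero]) (fun τ ↦ by
      simp only [cuspFunction_E2_qParam, cuspFunction_modularForm_qParam, normalizedDeriv_E₄])
  have hr6 := eventually_euler_cuspFunction (periodic_modularForm E₆) (ModularFormClass.holo E₆)
    (isBoundedAtImInfty_modularForm E₆)
    (G := fun q ↦ (cuspFunction 1 E2 q * cuspFunction 1 E₆ q - cuspFunction 1 E₄ q ^ 2) / 2)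
    (by simp [cuspFunction_E2_zero, cuspFunction_E₄_zero, cuspFunction_E₆_zero]) (fun τ ↦ by
      simp only [cuspFunction_E2_qParam, cuspFunction_modularForm_qParam, normalizedDeriv_E₆])
  have h := eventually_hasSum_of_ramanujan
    (analyticAt_cuspFunction_zero one_pos periodic_E2 E2_mdifferentiable isBoundedAtImInfty_E2)
    (analyticAt_cuspFunction_modularForm E₄) (analyticAt_cuspFunction_modularForm E₆)
    cuspFunction_E₄_zero cuspFunction_E₆_zero hr2 hr4 hr6
    (by rw [deriv_inv_J₁_coordinate]; norm_num)
  filter_upwards [(qParam_tendsto_atImInfty one_pos).eventually h] with τ hτ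
  simpa only [cuspFunction_E2_qParam, cuspFunction_modularForm_qParam] using hτ

end Hypergeometric

end Chudnovsky

/-! ### The two identities for large imaginary part. -/

theorem mainTheorem2 :
    ∃ C : ℝ, 0 < C ∧ ∀ τ : ℍ, C < τ.im →
      -- all the quantities below are well defined: the principal powers of `E₄`, the quotients
      -- by `E₆`, and the convergence of the power series in `1 / J₁`
      E₄ τ ∈ Complex.slitPlane ∧ E₆ τ ≠ 0 ∧ 1 < ‖Chudnovsky.J₁ τ‖ ∧
      HasSum
        (fun n : ℕ => Chudnovsky.coeff3F2 (1 / 2) (1 / 6) (5 / 6) 1 1 n * (1 / Chudnovsky.J₁ τ) ^ n)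
        (E₄ τ ^ (1 / 2 : ℂ)) ∧
      HasSum
        (fun n : ℕ =>
          (6 * (n : ℂ) + 1 - Chudnovsky.E₂star τ * E₄ τ / E₆ τ) *
            (Chudnovsky.R n 2 * Chudnovsky.R n 6 / Chudnovsky.J₁ τ ^ n))
        (3 / ((Real.pi : ℂ) * (τ.im : ℂ)) * (E₄ τ ^ (3 / 2 : ℂ) / E₆ τ)) := by
  open Chudnovsky Filter Topology in
  have t4 : Tendsto E₄ atImInfty (𝓝 1) :=
    cuspFunction_E₄_zero ▸ tendsto_modularForm_atImInfty E₄
  have t6 : Tendsto E₆ atImInfty (𝓝 1) :=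
    cuspFunction_E₆_zero ▸ tendsto_modularForm_atImInfty E₆
  have hs : ∀ᶠ τ in atImInfty, E₄ τ ∈ Complex.slitPlane :=
    t4.eventually (Complex.isOpen_slitPlane.mem_nhds (by simp))
  have h6 : ∀ᶠ τ in atImInfty, E₆ τ ≠ 0 := t6.eventually_ne one_ne_zero
  -- This quantity is `1 / J₁`, so the bound will give `|J₁| > 1`.
  have hx : ∀ᶠ τ in atImInfty, ‖1 - E₆ τ ^ 2 / E₄ τ ^ 3‖ < 1 := by
    have := (((t6.pow 2).div (t4.pow 3) (by simp)).const_sub 1).norm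
    simp only [one_pow, div_one, sub_self, norm_zero] at this
    exact this.eventually_lt_const one_pos
  obtain ⟨A, hA⟩ := (atImInfty_mem _).mp
    (hs.and (h6.and (hx.and eventually_hasSum_atImInfty)))
  refine ⟨max A 1, by positivity, fun τ hτ ↦ ?_⟩
  obtain ⟨hτs, hτ6, hτx, hsum, hsum'⟩ := hA τ ((le_max_left _ _).trans hτ.le)
  have hne := Complex.slitPlane_ne_zero hτs
  have hJ := J₁_ne_zero hne
  rw [← one_div_J₁ hne] at hτx hsum hsum'
  refine ⟨hτs, hτ6, ?_, hsum, ?_⟩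
  · rw [norm_div, norm_one] at hτx
    rwa [div_lt_one (norm_pos_iff.mpr hJ)] at hτx
  -- The factor `6n + 1 - E₂* E₄ / E₆` splits into `6n`, giving `6 θ f`, and a part independent of
  -- `n`, giving a multiple of `f`.
  · have h := (hsum'.mul_left 6).add (hsum.mul_left (1 - E₂star τ * E₄ τ / E₆ τ))
    have hpow : E₄ τ ^ (3 / 2 : ℂ) = E₄ τ ^ (1 / 2 : ℂ) * E₄ τ := by
      rw [show (3 / 2 : ℂ) = 1 / 2 + 1 by norm_num, Complex.cpow_add _ _ hne, Complex.cpow_one]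
    have hval : 3 / ((Real.pi : ℂ) * (τ.im : ℂ)) * (E₄ τ ^ (3 / 2 : ℂ) / E₆ τ) =
        6 * (E₄ τ ^ (1 / 2 : ℂ) * (EisensteinSeries.E2 τ * E₄ τ / E₆ τ - 1) / 6) +
          (1 - E₂star τ * E₄ τ / E₆ τ) * E₄ τ ^ (1 / 2 : ℂ) := by
      rw [hpow, E₂star]
      ring
    rw [hval]
    refine h.congr_fun fun n ↦ ?_
    rw [R_two_mul_R_six, one_div_pow]
    ring
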